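/- **Setting.** Let $V$ be a finite set of nodes. An oblivious network model $M$ on $V$ is the law of a random sequence $E_1,E_2,\dots\subseteq V\times V$ of sets of directed edges, where the active edge set $E_t$ of round $t$ depends only on $t$, on $E_{t'}$ for $t'<t$, and on randomness (no independence between the rounds is assumed). For $p\in[0,1]$ and $S\subseteq V$, the flooding process $F(M,p,S)$ is $S_1=S$ and $S_{t+1}=S_t\cup\{v:\ (u,v)\in E'_t\text{ for some }u\in S_t\}$, where $E'_t$ contains each edge of $E_t$ independently with probability $1-p$. Its stopping time is $\tau(M,p,S)=\min\{t\ge 1: S_t=V\}$ ($\infty$ if there is no such $t$). For $T,\alpha\in\mathbb R$ with $\alpha>0$, $M$ *floods in time $T$ with throughput $\alpha$* if there is a prime power $q$ such that for every $v\in V$ and every real $k>0$ $$\Pr[\tau(M,1/q,\{v\})\ge T+k]<q^{-\alpha k}.$$ Given $E_1,\dots,E_{T'}$, a *path* from $s$ to $d$ is a sequence $(v_0,\dots,v_{T'})$ of nodes with $v_0=s$, $v_{T'}=d$ and, for every $1\le t\le T'$, $v_{t-1}=v_t$ or $(v_{t-1},v_t)\in E_t$. A finite family of paths with nonnegative real weights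 is *valid* if for every $1\le t\le T'$ and every $(u,v)\in E_t$ with $u\ne v$, the weights of the paths with $v_{t-1}=u$ and $v_t=v$ sum to at most $1$. It *achieves capacity $c$ between $s$ and $d$* if the weights of its paths from $s$ to $d$ sum to $c$. **Lemma.** Let $M$ be an oblivious network model on a finite node set $V$ that floods in time $T$ with throughput $\alpha>0$. Let $T'\in\mathbb N$, $\epsilon>0$, let $d\in V$ be a destination, let $s_1,\dots,s_k\in V$ be distinct source nodes, and let $c_1,\dots,c_k\ge 1$ be integers. Let $E_1,\dots,E_{T'}$ be the active edge sets of the first $T'$ rounds sampled from $M$. If $$T'\ \ge\ T+\frac1\alpha\Big(\sum_{i=1}^k c_i+\log_2\epsilon^{-1}\Big),$$ then with probability at least $1-\epsilon$ there is one valid finite family of weighted paths that achieves, for every $i$ simultaneously, the capacity $c_i$ between $s_i$ and $d$. -/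

import Mathlib

open MeasureTheory ProbabilityTheory
open scoped ENNReal

/-- An oblivious network model on the node set `V`.

In such a model the active edge set of a round depends only on the round number, on the active
edge sets of the previous rounds and on randomness; equivalently (chain rule for conditional
distributions), the model is the joint law of a random sequence of directed edge sets that evolves
on its own. No independence or identical distribution between the rounds is required.

Rounds are numbered `1, 2, 3, …`; the active edge set `E_t` of round `t = i + 1` is the `i`-th
entry of the sequence. The pair `(u, v)` belongs to `E_t` iff the packet of `u` reaches `v` in
round `t`. -/
structure ObliviousNetworkModel (V : Type*) where
  /-- The joint law of the sequence `E_1, E_2, …` of active edge sets. -/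
  law : Measure (ℕ → Set (V × V))
  isProbabilityMeasure_law : IsProbabilityMeasure law

attribute [instance] ObliviousNetworkModel.isProbabilityMeasure_law

/-- The informed nodes when everybody in `S` is informed at time `1` and, in every round, every
informed node informs its out-neighbours: `floodSet E S i` is `S_{i + 1}`, where `S_1 = S` and
`S_{t + 1}` is obtained from `S_t` through the edges of round `t`. -/
def floodSet {V : Type*} (E : ℕ → Set (V × V)) (S : Set V) : ℕ → Set V
  | 0 => S
  | i + 1 => {v | ∃ u ∈ floodSet E S i, (u, v) ∈ E i ∨ v = u}

/-- The first time `t ∈ {1, 2, …}` with `S_t = V`, and `⊤` if there is none. -/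
noncomputable def floodTime {V : Type*} (E : ℕ → Set (V × V)) (S : Set V) : ℕ∞ :=
  ⨅ (i : ℕ) (_ : floodSet E S i = Set.univ), ((i + 1 : ℕ) : ℕ∞)

namespace ObliviousNetworkModel

variable {V : Type*}

/-- The joint law of the active edge sets and of independent sets of edge slots that are not
faulty: independently of the active edge sets, every pair (round, directed edge) is kept with
probability `1 - p`, independently of all others. -/
noncomputable def faultyLaw (M : ObliviousNetworkModel V) (p : unitInterval) :
    Measure ((ℕ → Set (V × V)) × (ℕ → Set (V × V))) :=
  M.law.prod (Measure.infinitePi fun _ : ℕ =>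
    setBernoulli (Set.univ : Set (V × V)) (unitInterval.symm p))

/-- The stopping time of the flooding process with fault probability `p` started in `S`, as a
random variable under `M.faultyLaw p`: only the active edges that are kept transmit. -/
noncomputable def faultyFloodTime (S : Set V)
    (ω : (ℕ → Set (V × V)) × (ℕ → Set (V × V))) : ℕ∞ :=
  floodTime (fun i => ω.1 i ∩ ω.2 i) S

/-- The fault probability `1 / q`. -/
noncomputable def faultProb (q : ℕ) : unitInterval :=
  ⟨1 / (q : ℝ), by positivity, by simpa using Nat.cast_inv_le_one q⟩

/-- `M` floods in time `T` with throughput `α`: there is a prime power `q` such that for every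
start node `v` and every `k > 0`, the flooding process with fault probability `1 / q` started in
`{v}` has a stopping time of at least `T + k` with probability less than `q ^ (-α k)`. -/
def Floods (M : ObliviousNetworkModel V) (T α : ℝ) : Prop :=
  ∃ q : ℕ, IsPrimePow q ∧ ∀ (v : V) (k : ℝ), 0 < k →
    (M.faultyLaw (faultProb q)).real
      {ω | ENNReal.ofReal (T + k) ≤ ((faultyFloodTime {v} ω : ℕ∞) : ℝ≥0∞)}
        < (q : ℝ) ^ (-α * k)

end ObliviousNetworkModel

/-- `P = (v_0, …, v_n)` is a path through the rounds `1, …, n`: in every round it stays where it is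
or follows an active edge of that round. -/
def IsTimedPath {V : Type*} (E : ℕ → Set (V × V)) (n : ℕ) (P : Fin (n + 1) → V) : Prop :=
  ∀ t : Fin n, P t.castSucc = P t.succ ∨ (P t.castSucc, P t.succ) ∈ E t

/-- A finite family of paths with nonnegative weights. -/
structure WeightedPaths {V : Type*} (E : ℕ → Set (V × V)) (n : ℕ) where
  /-- the number of paths -/
  m : ℕ
  path : Fin m → Fin (n + 1) → V
  isTimedPath : ∀ j, IsTimedPath E n (path j)
  weight : Fin m → ℝ
  weight_nonneg : ∀ j, 0 ≤ weight j

namespace WeightedPaths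

variable {V : Type*} {E : ℕ → Set (V × V)} {n : ℕ}

open Classical in
/-- For every round and every active edge of that round, the weights of the paths that use the edge
in that round add up to at most one. Staying at a node does not use an edge. -/
def Valid (W : WeightedPaths E n) : Prop :=
  ∀ (t : Fin n) (u v : V), u ≠ v → (u, v) ∈ E t →
    ∑ j with W.path j t.castSucc = u ∧ W.path j t.succ = v, W.weight j ≤ 1

open Classical in
/-- The weights of the paths from `s` to `d` add up to `c`. -/
def AchievesCapacity (W : WeightedPaths E n) (s d : V) (c : ℝ) : Prop :=
  ∑ j with W.path j 0 = s ∧ W.path j (Fin.last n) = d, W.weight j = c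

end WeightedPaths

/-! If the capacities are not achieved, max-flow min-cut in the time-expanded network gives growing
sets `X t` that miss `d` at the end and are left by only `m` active edges, where `m` is less than
the sum of the `c i` over `I`, the sources inside `X 0`. When all `m` edges are faulty, no flood
from a source in `I` reaches `d`. So, given such edge sets, the failure probabilities of the `k`
floods sum to at least `|I| q^(-m)`, which is at least `k q^(-C)` with `C = ∑ c i`. On average over
the edge sets, each flood fails with probability at most `q^(-C) ε` by the throughput assumption.
Markov's inequality then bounds the probability of a bad edge sequence by `ε`. Comparing sums over
the sources avoids a union bound over cuts and loses no factor `k`. The carrying lemmas are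
`exists_weightedPaths_or_cut`, `card_mul_pow_le_sum_of_cut` and `card_mul_pow_le_of_sum_lt`. -/

/-! ### Feasible flows from cut conditions -/

/-- Layer-cake inequality: a family of cut conditions on the superlevel sets of a potential `z`
integrates to an inequality for `z`. -/
lemma sum_mul_le_of_cut_condition {N A : Type*} [Fintype N] [DecidableEq N] [Fintype A]
    (src tgt : A → N) (cap : A → ℝ) (b : N → ℝ) (hb0 : ∑ x, b x = 0)
    (hb : ∀ X : Finset N, ∑ x ∈ X, b x ≤ ∑ a with src a ∈ X ∧ tgt a ∉ X, cap a) (z : N → ℝ) :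
    ∑ x, b x * z x ≤ ∑ a, cap a * max (z (src a) - z (tgt a)) 0 := by
  -- Levels are integrated from `-M` upwards to keep the integrals finite; the shift by `M` cancels
  -- at the end because `b` sums to zero.
  obtain ⟨M, hM⟩ : ∃ M : ℝ, ∀ x, -M ≤ z x := by
    obtain ⟨B, hB⟩ := (Set.finite_range z).bddBelow
    exact ⟨-B, fun x => by simpa using hB ⟨x, rfl⟩⟩
  have hint : ∀ p r : ℝ, Integrable ((Set.Ico p r).indicator (1 : ℝ → ℝ)) := fun p r =>
    (integrable_indicator_iff measurableSet_Ico).2 (integrableOn_const (by simp) (by simp))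
  have hval : ∀ p r : ℝ, ∫ θ, (Set.Ico p r).indicator (1 : ℝ → ℝ) θ = max (r - p) 0 := fun p r => by
    rw [integral_indicator_one measurableSet_Ico, Real.volume_real_Ico]
  have key : ∫ θ, ∑ x, b x * (Set.Ico (-M) (z x)).indicator (1 : ℝ → ℝ) θ
      ≤ ∫ θ, ∑ a, cap a * (Set.Ico (z (tgt a)) (z (src a))).indicator (1 : ℝ → ℝ) θ := by
    refine integral_mono (integrable_finsetSum _ fun x _ => (hint _ _).const_mul _)
      (integrable_finsetSum _ fun x _ => (hint _ _).const_mul _) fun θ => ?_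
    by_cases hθ : -M ≤ θ
    · have h := hb (Finset.univ.filter fun x => θ < z x)
      rw [Finset.sum_filter, Finset.sum_filter] at h
      refine (Eq.le ?_).trans (h.trans (Eq.le ?_))
      · exact Finset.sum_congr rfl fun x _ => by simp [Set.indicator_apply, hθ]
      · exact Finset.sum_congr rfl fun a _ => by simp [Set.indicator_apply, and_comm]
    · have h1 : ∀ x, ¬ z x ≤ θ := fun x h => hθ ((hM x).trans h)
      simp [hθ, h1]
  rw [integral_finsetSum _ fun x _ => (hint _ _).const_mul _,
    integral_finsetSum _ fun x _ => (hint _ _).const_mul _] at key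
  simp only [integral_const_mul, hval] at key
  refine le_trans (Eq.le ?_) key
  have h2 : ∀ x, b x * max (z x - -M) 0 = b x * z x + b x * M := fun x => by
    rw [max_eq_left (by linarith [hM x])]; ring
  simp only [h2, Finset.sum_add_distrib, ← Finset.sum_mul, hb0, zero_mul, add_zero]

/-- Gale's supply-demand theorem: if every set of nodes can get rid of its net supply through the
arcs that leave it, there is a feasible flow. -/
theorem exists_flow_of_cut_condition {N A : Type*} [Fintype N] [DecidableEq N] [Fintype A]
    (src tgt : A → N) (cap : A → ℝ) (hcap : ∀ a, 0 ≤ cap a) (b : N → ℝ) (hb0 : ∑ x, b x = 0)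
    (hb : ∀ X : Finset N, ∑ x ∈ X, b x ≤ ∑ a with src a ∈ X ∧ tgt a ∉ X, cap a) :
    ∃ f : A → ℝ, (∀ a, 0 ≤ f a) ∧ (∀ a, f a ≤ cap a) ∧
      ∀ x, ∑ a with src a = x, f a = ∑ a with tgt a = x, f a + b x := by
  let D : (A → ℝ) →ₗ[ℝ] (N → ℝ) :=
    { toFun := fun f x => ∑ a, ((if src a = x then f a else 0) - if tgt a = x then f a else 0)
      map_add' := fun f g => by
        ext x
        simp only [Pi.add_apply, ← Finset.sum_add_distrib]
        exact Finset.sum_congr rfl fun a _ => by split_ifs <;> ring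
      map_smul' := fun r f => by
        ext x
        simp only [Pi.smul_apply, smul_eq_mul, RingHom.id_apply, Finset.mul_sum]
        exact Finset.sum_congr rfl fun a _ => by split_ifs <;> ring }
  have hD : Continuous D := D.continuous_of_finiteDimensional
  have hclosed : IsClosed (D '' Set.Icc 0 cap) := (isCompact_Icc.image hD).isClosed
  have hconv : Convex ℝ (D '' Set.Icc 0 cap) := (convex_Icc _ _).linear_image D
  by_cases hmem : b ∈ D '' Set.Icc 0 cap
  · obtain ⟨f, hf, hfb⟩ := hmem
    refine ⟨f, fun a => hf.1 a, fun a => hf.2 a, fun x => ?_⟩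
    have h := congrFun hfb x
    simp only [D, LinearMap.coe_mk, AddHom.coe_mk, Finset.sum_sub_distrib] at h
    rw [Finset.sum_filter, Finset.sum_filter]
    linarith
  · exfalso
    obtain ⟨L, u, hLu, huL⟩ := geometric_hahn_banach_closed_point hconv hclosed hmem
    -- The coordinates of the separating functional serve as node potentials.
    set z : N → ℝ := fun x => L (Pi.single x 1) with hz
    have hL : ∀ y : N → ℝ, L y = ∑ x, y x * z x := fun y => by
      conv_lhs => rw [← Finset.univ_sum_single y]
      rw [map_sum]
      refine Finset.sum_congr rfl fun x _ => ?_
      rw [hz, ← smul_eq_mul, ← map_smul, ← Pi.single_smul, smul_eq_mul, mul_one]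
    -- This flow maximizes the functional over the box: it saturates exactly the arcs along which
    -- the potential drops.
    let f : A → ℝ := fun a => if z (tgt a) < z (src a) then cap a else 0
    have hf : f ∈ Set.Icc 0 cap :=
      ⟨fun a => by simp only [f]; split_ifs <;> simp [hcap a],
        fun a => by simp only [f]; split_ifs <;> simp [hcap a]⟩
    have h1 := (hLu _ ⟨f, hf, rfl⟩).trans huL
    rw [hL, hL] at h1
    refine absurd h1 (not_lt.2 ((sum_mul_le_of_cut_condition src tgt cap b hb0 hb z).trans
      (Eq.le ?_)))
    simp only [D, LinearMap.coe_mk, AddHom.coe_mk, Finset.sum_mul]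
    rw [Finset.sum_comm]
    refine Finset.sum_congr rfl fun a _ => ?_
    simp only [sub_mul, ite_mul, zero_mul, Finset.sum_sub_distrib, Finset.sum_ite_eq,
      Finset.mem_univ, if_true, f]
    split_ifs with h
    · rw [max_eq_left (by linarith)]; ring
    · rw [max_eq_right (by linarith)]; ring

/-! ### Path decomposition and the time-expanded network -/

/-- A layered flow decomposes into weighted paths. -/
lemma exists_path_weights {V : Type*} [Fintype V] [DecidableEq V] (n : ℕ)
    (g : Fin n → V → V → ℝ) (m : Fin (n + 1) → V → ℝ) (hg : ∀ t u v, 0 ≤ g t u v)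
    (hm : ∀ v, 0 ≤ m 0 v)
    (hout : ∀ t u, ∑ v, g t u v = m t.castSucc u) (hin : ∀ t v, ∑ u, g t u v = m t.succ v) :
    ∃ w : (Fin (n + 1) → V) → ℝ, (∀ P, 0 ≤ w P) ∧
      (∀ t v, ∑ P with P t = v, w P = m t v) ∧
      ∀ t u v, ∑ P with P t.castSucc = u ∧ P t.succ = v, w P = g t u v := by
  induction n with
  | zero =>
    refine ⟨fun P => m 0 (P 0), fun P => hm _, fun t v => ?_, fun t => t.elim0⟩
    obtain rfl := Subsingleton.elim (α := Fin 1) t 0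
    rw [Finset.sum_eq_single (fun _ => v)]
    · intro P hP hne
      refine absurd (funext fun t => ?_) hne
      obtain rfl := Subsingleton.elim (α := Fin 1) t 0
      exact (Finset.mem_filter.1 hP).2
    · simp
  | succ n ih =>
    have hm1 : ∀ v, 0 ≤ m 1 v := fun v => by
      have := hin 0 v
      rw [Fin.succ_zero_eq_one] at this
      rw [← this]
      exact Finset.sum_nonneg fun u _ => hg _ _ _
    obtain ⟨w, hw0, hwm, hwg⟩ := ih (fun t => g t.succ) (fun t => m t.succ)
      (fun t => hg _) hm1 (fun t u => hout t.succ u) (fun t v => hin t.succ v)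
    have hin0 : ∀ v, ∑ u, g 0 u v = m 1 v := fun v => hin 0 v
    have hg0 : ∀ u v, m 1 v = 0 → g 0 u v = 0 := fun u v h => by
      rw [← hin0, Finset.sum_eq_zero_iff_of_nonneg fun _ _ => hg _ _ _] at h
      exact h u (Finset.mem_univ _)
    have hw1 : ∀ P, m 1 (P 0) = 0 → w P = 0 := fun P h => by
      have h2 := hwm 0 (P 0)
      rw [Fin.succ_zero_eq_one, h, Finset.sum_eq_zero_iff_of_nonneg fun _ _ => hw0 _] at h2
      exact h2 P (by simp)
    -- A path is prolonged backwards as in a Markov chain: its weight is split in proportion to the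
    -- flow entering its first node. Where `m 1` vanishes the quotient is `0`, which is harmless by
    -- `hg0` and `hw1`.
    let w' : (Fin (n + 2) → V) → ℝ := fun Q => w (Fin.tail Q) * (g 0 (Q 0) (Q 1) / m 1 (Q 1))
    have hcons : ∀ u P, w' (Fin.cons u P) = w P * (g 0 u (P 0) / m 1 (P 0)) := fun u P => by
      simp only [w', Fin.tail_cons, Fin.cons_zero]
      rw [← Fin.succ_zero_eq_one, Fin.cons_succ]
    have hsum : ∀ F : (Fin (n + 2) → V) → ℝ, ∑ Q, F Q = ∑ P, ∑ u, F (Fin.cons u P) := fun F => by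
      rw [← (Fin.consEquiv fun _ => V).sum_comp, Fintype.sum_prod_type_right]
      rfl
    have hmarg : ∀ P, ∑ u, w' (Fin.cons u P) = w P := fun P => by
      simp only [hcons, ← Finset.mul_sum, ← Finset.sum_div, hin0]
      by_cases h : m 1 (P 0) = 0
      · simp [hw1 P h]
      · rw [div_self h, mul_one]
    have hedge : ∀ u v, ∑ P with P 0 = v, w' (Fin.cons u P) = g 0 u v := fun u v => by
      have h1 : ∑ P with P 0 = v, w' (Fin.cons u P)
          = ∑ P with P 0 = v, w P * (g 0 u v / m 1 v) := by
        refine Finset.sum_congr rfl fun P hP => ?_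
        rw [hcons, (Finset.mem_filter.1 hP).2]
      rw [h1, ← Finset.sum_mul, hwm, Fin.succ_zero_eq_one]
      by_cases h : m 1 v = 0
      · rw [h, hg0 u v h]; simp
      · field_simp
    refine ⟨w', fun Q => mul_nonneg (hw0 _) (div_nonneg (hg _ _ _) (hm1 _)), fun t v => ?_,
      fun t u v => ?_⟩
    · rw [Finset.sum_filter, hsum]
      cases t using Fin.cases with
      | zero =>
        simp only [Fin.cons_zero]
        rw [Finset.sum_comm]
        simp only [Finset.sum_ite_irrel, Finset.sum_const_zero, Finset.sum_ite_eq',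
          Finset.mem_univ, if_true]
        rw [← Fin.castSucc_zero, ← hout, ← Finset.sum_fiberwise _ fun P : Fin (n + 1) → V => P 0]
        exact Finset.sum_congr rfl fun x _ => hedge v x
      | succ t =>
        simp only [Fin.cons_succ, Finset.sum_ite_irrel, Finset.sum_const_zero, hmarg]
        rw [← Finset.sum_filter, hwm]
    · rw [Finset.sum_filter, hsum]
      cases t using Fin.cases with
      | zero =>
        simp only [Fin.castSucc_zero, Fin.cons_zero, Fin.cons_succ]
        rw [Finset.sum_comm, ← hedge u v, Finset.sum_filter]
        simp only [ite_and, Finset.sum_ite_irrel, Finset.sum_const_zero, Finset.sum_ite_eq',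
          Finset.mem_univ, if_true]
      | succ t =>
        simp only [← Fin.succ_castSucc, Fin.cons_succ, Finset.sum_ite_irrel,
          Finset.sum_const_zero, hmarg]
        rw [← Finset.sum_filter, hwg]

open Classical in
/-- Max-flow min-cut in the time-expanded network: either the prescribed capacities are achieved
simultaneously, or they are obstructed by a growing family of node sets. -/
theorem exists_weightedPaths_or_cut {V : Type*} [Fintype V] (E : ℕ → Set (V × V)) (n : ℕ) (d : V)
    {k : ℕ} (s : Fin k → V) (hs : Function.Injective s) (c : Fin k → ℕ) :
    (∃ W : WeightedPaths E n, W.Valid ∧ ∀ i, W.AchievesCapacity (s i) d (c i : ℝ)) ∨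
    ∃ X : ℕ → Set V, (∀ t < n, X t ⊆ X (t + 1)) ∧ d ∉ X n ∧
      ∑ t ∈ Finset.range n, {e : V × V | e ∈ E t ∧ e.1 ∈ X t ∧ e.2 ∉ X (t + 1)}.ncard
        < ∑ i with s i ∈ X 0, c i := by
  set C : ℝ := ∑ i, (c i : ℝ) with hC
  have hC0 : 0 ≤ C := Finset.sum_nonneg fun _ _ => Nat.cast_nonneg _
  let src : Fin n × V × V → Fin (n + 1) × V := fun a => (a.1.castSucc, a.2.1)
  let tgt : Fin n × V × V → Fin (n + 1) × V := fun a => (a.1.succ, a.2.2)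
  -- Waiting arcs get capacity `C`, the total supply, which acts as infinity.
  let cap : Fin n × V × V → ℝ := fun a =>
    if a.2.1 = a.2.2 then C else if a.2 ∈ E a.1 then 1 else 0
  have hcap : ∀ a, 0 ≤ cap a := fun a => by
    simp only [cap]; split_ifs <;> simp [hC0]
  let b : Fin (n + 1) × V → ℝ := fun x =>
    (∑ i, if ((0, s i) : Fin (n + 1) × V) = x then (c i : ℝ) else 0)
      - if ((Fin.last n, d) : Fin (n + 1) × V) = x then C else 0
  have hbX : ∀ X : Finset (Fin (n + 1) × V), ∑ x ∈ X, b x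
      = (∑ i with (0, s i) ∈ X, (c i : ℝ)) - if (Fin.last n, d) ∈ X then C else 0 := fun X => by
    simp only [b, Finset.sum_sub_distrib]
    rw [Finset.sum_comm]
    simp only [Finset.sum_ite_eq, Finset.sum_filter]
  have hb0 : ∑ x, b x = 0 := by
    rw [hbX]; simp [hC]
  by_cases h : ∀ X : Finset (Fin (n + 1) × V),
      ∑ x ∈ X, b x ≤ ∑ a with src a ∈ X ∧ tgt a ∉ X, cap a
  · left
    obtain ⟨f, hf0, hfcap, hf⟩ := exists_flow_of_cut_condition src tgt cap hcap b hb0 h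
    have hsrc : ∀ (t : Fin n) u, ∑ a with src a = (t.castSucc, u), f a = ∑ v, f (t, u, v) := by
      intro t u
      rw [Finset.sum_filter, Fintype.sum_prod_type, Finset.sum_eq_single t _ (by simp)]
      · rw [Fintype.sum_prod_type, Finset.sum_eq_single u _ (by simp)]
        · simp [src]
        · intro u' _ hu'
          simp [src, hu']
      · intro t' _ ht'
        simp [src, ht']
    have htgt : ∀ (t : Fin n) v, ∑ a with tgt a = (t.succ, v), f a = ∑ u, f (t, u, v) := by
      intro t v
      rw [Finset.sum_filter, Fintype.sum_prod_type, Finset.sum_eq_single t _ (by simp)]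
      · rw [Fintype.sum_prod_type]
        simp [tgt]
      · intro t' _ ht'
        simp [tgt, ht']
    -- The amount passing through a node: outflow plus demand or, by conservation, inflow plus
    -- supply.
    let m : Fin (n + 1) → V → ℝ := fun t v =>
      (∑ a with src a = (t, v), f a) + if ((Fin.last n, d) : Fin (n + 1) × V) = (t, v) then C else 0
    have hm' : ∀ t v, m t v = (∑ a with tgt a = (t, v), f a)
        + ∑ i, if ((0, s i) : Fin (n + 1) × V) = (t, v) then (c i : ℝ) else 0 := fun t v => by
      simp only [m, hf, b]; ring
    have hm0 : ∀ v, m 0 v = ∑ i, if s i = v then (c i : ℝ) else 0 := fun v => by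
      rw [hm', Finset.sum_eq_zero, zero_add]
      · simp
      · intro a ha
        simp [tgt] at ha
    have hmlast : ∀ v, v ≠ d → m (Fin.last n) v = 0 := fun v hv => by
      simp only [m]
      rw [Finset.sum_eq_zero, zero_add]
      · simp [hv.symm]
      · intro a ha
        simp [src, Fin.castSucc_ne_last] at ha
    obtain ⟨w, hw0, hwm, hwg⟩ := exists_path_weights n (fun t u v => f (t, u, v)) m
      (fun _ _ _ => hf0 _)
      (fun v => by
        rw [hm0]
        exact Finset.sum_nonneg fun i _ => by split_ifs <;> simp)
      (fun t u => by simp [m, hsrc, (Fin.castSucc_ne_last t).symm])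
      (fun t v => by simp [hm', htgt, (Fin.succ_ne_zero t).symm])
    have hwP : ∀ P, ¬ IsTimedPath E n P → w P = 0 := fun P hP => by
      simp only [IsTimedPath, not_forall, not_or] at hP
      obtain ⟨t, h1, h2⟩ := hP
      have h3 : f (t, P t.castSucc, P t.succ) = 0 :=
        le_antisymm ((hfcap _).trans (by simp [cap, h1, h2])) (hf0 _)
      have h4 := hwg t (P t.castSucc) (P t.succ)
      rw [h3, Finset.sum_eq_zero_iff_of_nonneg fun _ _ => hw0 _] at h4
      exact h4 P (by simp)
    have hwd : ∀ P, P (Fin.last n) ≠ d → w P = 0 := fun P hP => by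
      have h4 := hwm (Fin.last n) (P (Fin.last n))
      rw [hmlast _ hP, Finset.sum_eq_zero_iff_of_nonneg fun _ _ => hw0 _] at h4
      exact h4 P (by simp)
    let e := Fintype.equivFin {P : Fin (n + 1) → V // IsTimedPath E n P}
    have hsum : ∀ p : (Fin (n + 1) → V) → Prop,
        ∑ j with p (e.symm j).1, w (e.symm j).1 = ∑ P with p P, w P := fun p => by
      rw [Finset.sum_filter, Finset.sum_filter,
        e.symm.sum_comp fun P => if p P.1 then w P.1 else 0,
        ← Finset.sum_subtype (Finset.univ.filter (IsTimedPath E n)) (by simp)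
          (fun P => if p P then w P else 0), Finset.sum_filter]
      refine Finset.sum_congr rfl fun P _ => ?_
      by_cases hP : IsTimedPath E n P
      · rw [if_pos hP]
      · rw [if_neg hP, hwP P hP, ite_self]
    refine ⟨⟨_, fun j => (e.symm j).1, fun j => (e.symm j).2, fun j => w (e.symm j).1,
      fun j => hw0 _⟩, fun t u v huv hE => ?_, fun i => ?_⟩
    · refine (Eq.le ?_).trans ((hfcap (t, u, v)).trans (Eq.le ?_))
      · rw [← hwg]
        convert hsum fun P => P t.castSucc = u ∧ P t.succ = v
      · simp [cap, huv, hE]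
    · have h5 : ∑ P with P 0 = s i ∧ P (Fin.last n) = d, w P = ∑ P with P 0 = s i, w P := by
        rw [Finset.sum_filter, Finset.sum_filter]
        refine Finset.sum_congr rfl fun P _ => ?_
        by_cases hP : P (Fin.last n) = d
        · simp [hP]
        · simp [hwd P hP]
      have h6 : ∑ P with P 0 = s i, w P = c i := by
        rw [hwm, hm0]
        simp [hs.eq_iff]
      rw [← h6, ← h5]
      unfold WeightedPaths.AchievesCapacity
      convert hsum fun P => P 0 = s i ∧ P (Fin.last n) = d
  · right
    push Not at h
    obtain ⟨X, hX⟩ := h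
    have hcut0 : 0 ≤ ∑ a with src a ∈ X ∧ tgt a ∉ X, cap a := Finset.sum_nonneg fun _ _ => hcap _
    have hIC : (∑ i with (0, s i) ∈ X, (c i : ℝ)) ≤ C :=
      Finset.sum_le_univ_sum_of_nonneg fun _ => Nat.cast_nonneg _
    rw [hbX] at hX
    have hd : (Fin.last n, d) ∉ X := fun hd => by
      rw [if_pos hd] at hX
      linarith
    rw [if_neg hd, sub_zero] at hX
    -- A waiting arc leaving `X` would alone cost `C`, too much for a violated cut.
    have hmem : ∀ (t : Fin n) v, (t.castSucc, v) ∈ X → (t.succ, v) ∈ X := fun t v h1 => by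
      by_contra h2
      have h3 : cap (t, v, v) ≤ ∑ a with src a ∈ X ∧ tgt a ∉ X, cap a :=
        Finset.single_le_sum (f := cap) (fun _ _ => hcap _) (by simp [src, tgt, h1, h2])
      simp only [cap, if_true] at h3
      linarith
    let Y : ℕ → Set V := fun t => {v | ∃ h : t < n + 1, (⟨t, h⟩, v) ∈ X}
    have hY : ∀ (t : Fin (n + 1)) v, v ∈ Y t ↔ (t, v) ∈ X := fun t v => by
      exact ⟨fun h => h.2, fun h => ⟨t.2, h⟩⟩
    refine ⟨Y, fun t ht v hv => ?_, fun h1 => hd ((hY (Fin.last n) d).1 h1), ?_⟩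
    · exact (hY (Fin.succ ⟨t, ht⟩) v).2 (hmem ⟨t, ht⟩ v ((hY (Fin.castSucc ⟨t, ht⟩) v).1 hv))
    · have hI : ∀ i, s i ∈ Y 0 ↔ (0, s i) ∈ X := fun i => hY 0 (s i)
      simp only [hI]
      rw [← @Nat.cast_lt ℝ]
      push_cast
      refine lt_of_le_of_lt ?_ hX
      rw [Finset.sum_range, Finset.sum_filter, Fintype.sum_prod_type]
      refine Finset.sum_le_sum fun t _ => ?_
      rw [Set.ncard_eq_toFinset_card', Finset.card_eq_sum_ones, Nat.cast_sum, ← Finset.sum_filter]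
      rw [Set.toFinset_ofPred, Finset.sum_filter, Finset.sum_filter]
      refine Finset.sum_le_sum fun e _ => ?_
      have h1 := hY t.castSucc e.1
      have h2 := hY t.succ e.2
      rw [Fin.val_castSucc] at h1
      rw [Fin.val_succ] at h2
      simp only [h1, h2, src, tgt]
      by_cases he : e ∈ E t ∧ (t.castSucc, e.1) ∈ X ∧ (t.succ, e.2) ∉ X
      · have h3 : e.1 ≠ e.2 := fun h3 => he.2.2 (h3 ▸ hmem t _ he.2.1)
        simp [he, cap, h3]
      · rw [if_neg he]
        split_ifs
        · exact hcap _
        · exact le_rfl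

/-! ### Flooding and independent faults -/

lemma floodSet_mono {V : Type*} (E : ℕ → Set (V × V)) (S : Set V) : Monotone (floodSet E S) :=
  monotone_nat_of_le_succ fun _ v hv => ⟨v, hv, Or.inr rfl⟩

/-- `floodSet E S n` is the informed set at time `n + 1`, so the flood is unfinished at that time.
-/
lemma lt_floodTime_of_notMem {V : Type*} {E : ℕ → Set (V × V)} {S : Set V} {n : ℕ} {d : V}
    (h : d ∉ floodSet E S n) : ((n + 1 : ℕ) : ℕ∞) ≤ floodTime E S := by
  refine le_iInf₂ fun i hi => ?_
  rw [Nat.cast_le]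
  by_contra! hlt
  exact h (floodSet_mono E S (by lia : i ≤ n) (hi ▸ Set.mem_univ d))

/-- The flood stays inside a growing family of node sets none of whose leaving edges is active. -/
lemma floodSet_subset_of_no_leaving_edge {V : Type*} {E : ℕ → Set (V × V)} {S : Set V} {n : ℕ}
    {X : ℕ → Set V} (hS : S ⊆ X 0) (hX : ∀ t < n, X t ⊆ X (t + 1))
    (hE : ∀ t < n, ∀ e ∈ E t, e.1 ∈ X t → e.2 ∈ X (t + 1)) :
    ∀ t ≤ n, floodSet E S t ⊆ X t := by
  intro t
  induction t with
  | zero => exact fun _ => hS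
  | succ t ih =>
    rintro ht v ⟨u, hu, huv | rfl⟩
    · exact hE t ht _ huv (ih (by lia) hu)
    · exact hX t ht (ih (by lia) hu)

lemma measurableSet_mem_floodSet {V : Type*} [Finite V] (S : Set V) (n : ℕ) (v : V) :
    MeasurableSet {ω : (ℕ → Set (V × V)) × (ℕ → Set (V × V)) |
      v ∈ floodSet (fun i => ω.1 i ∩ ω.2 i) S n} := by
  induction n generalizing v with
  | zero => simp [floodSet]
  | succ n ih =>
    simp only [floodSet, Set.mem_ofPred_eq, Set.mem_inter_iff]
    refine measurableSet_setOfPred.2 (Measurable.exists fun u => ?_)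
    refine (measurableSet_setOfPred.1 (ih u)).and (Measurable.or (Measurable.and ?_ ?_) measurable_const)
    · exact (measurable_set_mem _).comp ((measurable_pi_apply n).comp measurable_fst)
    · exact (measurable_set_mem _).comp ((measurable_pi_apply n).comp measurable_snd)

lemma setBernoulli_univ_disjoint {ι : Type*} [Finite ι] (p : unitInterval) (K : Set ι) :
    setBernoulli (Set.univ : Set ι) (unitInterval.symm p) {F | Disjoint F K}
      = (unitInterval.toNNReal p : ℝ≥0∞) ^ K.ncard := by
  classical
  have := Fintype.ofFinite ι
  rw [setBernoulli_apply']
  have h : (fun p : ι → Prop => {i | p i}) ⁻¹' {F | Disjoint F K}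
      = Set.pi (K.toFinset : Set ι) fun _ => {False} := by
    ext F
    simp [Set.disjoint_right]
  rw [h, Measure.infinitePi_pi _ (fun _ _ => .of_discrete), Set.ncard_eq_toFinset_card']
  rw [← Finset.prod_const]
  refine Finset.prod_congr rfl fun i _ => ?_
  simp

lemma infinitePi_setBernoulli_disjoint {ι : Type*} [Finite ι] (p : unitInterval) (n : ℕ)
    (K : ℕ → Set ι) :
    (Measure.infinitePi fun _ : ℕ => setBernoulli (Set.univ : Set ι) (unitInterval.symm p)).real
      {F | ∀ t < n, Disjoint (F t) (K t)} = (p : ℝ) ^ ∑ t ∈ Finset.range n, (K t).ncard := by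
  have h : {F : ℕ → Set ι | ∀ t < n, Disjoint (F t) (K t)}
      = Set.pi (Finset.range n : Set ℕ) fun t => {F | Disjoint F (K t)} := by
    ext F
    simp
  rw [h, Measure.real, Measure.infinitePi_pi _ (fun _ _ => .of_discrete)]
  simp only [setBernoulli_univ_disjoint, Finset.prod_pow_eq_pow_sum]
  simp

/-- Markov's inequality for the sections of finitely many events in a product space. -/
lemma mul_measureReal_le_sum_prod {Ω Ω' ι : Type*} [MeasurableSpace Ω] [MeasurableSpace Ω']
    [Fintype ι] (μ : Measure Ω) [IsProbabilityMeasure μ] (ν : Measure Ω') [IsProbabilityMeasure ν]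
    (A : ι → Set (Ω × Ω')) (hA : ∀ i, MeasurableSet (A i)) (B : Set Ω) {a : ℝ} (ha : 0 ≤ a)
    (hB : ∀ x ∈ B, a ≤ ∑ i, ν.real {y | (x, y) ∈ A i}) :
    a * μ.real B ≤ ∑ i, (μ.prod ν).real (A i) := by
  have hmeas : ∀ i, Measurable fun x => ν {y | (x, y) ∈ A i} := fun i =>
    measurable_measure_prodMk_left (hA i)
  have h1 : ENNReal.ofReal a * μ B ≤ ∑ i, (μ.prod ν) (A i) := by
    calc ENNReal.ofReal a * μ B
        ≤ ENNReal.ofReal a * μ {x | ENNReal.ofReal a ≤ ∑ i, ν {y | (x, y) ∈ A i}} := by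
          -- `B` need not be measurable: it is enlarged to a superlevel set of a measurable
          -- function.
          gcongr
          intro x hx
          refine (ENNReal.ofReal_le_ofReal (hB x hx)).trans (Eq.le ?_)
          rw [ENNReal.ofReal_sum_of_nonneg fun _ _ => measureReal_nonneg]
          simp
      _ ≤ ∫⁻ x, ∑ i, ν {y | (x, y) ∈ A i} ∂μ :=
          mul_meas_ge_le_lintegral (Finset.measurable_sum _ fun i _ => hmeas i) _
      _ = ∑ i, (μ.prod ν) (A i) := by
          rw [lintegral_finsetSum _ fun i _ => hmeas i]
          exact Finset.sum_congr rfl fun i _ => (Measure.prod_apply (hA i)).symm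
  have h2 := ENNReal.toReal_mono (by simp) h1
  rwa [ENNReal.toReal_mul, ENNReal.toReal_ofReal ha, ENNReal.toReal_sum (by simp)] at h2

namespace ObliviousNetworkModel

instance {V : Type*} (M : ObliviousNetworkModel V) (p : unitInterval) :
    IsProbabilityMeasure (M.faultyLaw p) := by
  unfold faultyLaw; infer_instance

end ObliviousNetworkModel

/-! ### Failed floods and the final estimate -/

/-- The flood from every source of an obstructing cut is stopped when all edges of the cut are
faulty. -/
lemma card_mul_pow_le_sum_of_cut {V : Type*} [Finite V] (E : ℕ → Set (V × V)) (n : ℕ) (d : V)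
    {k : ℕ} (s : Fin k → V) (p : unitInterval) {X : ℕ → Set V}
    (hX : ∀ t < n, X t ⊆ X (t + 1)) (hd : d ∉ X n) (I : Finset (Fin k)) (hI : ∀ i ∈ I, s i ∈ X 0) :
    (I.card : ℝ) * (p : ℝ) ^ ∑ t ∈ Finset.range n,
        {e : V × V | e ∈ E t ∧ e.1 ∈ X t ∧ e.2 ∉ X (t + 1)}.ncard
      ≤ ∑ i, (Measure.infinitePi fun _ : ℕ =>
          setBernoulli (Set.univ : Set (V × V)) (unitInterval.symm p)).real
            {F | d ∉ floodSet (fun t => E t ∩ F t) {s i} n} := by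
  rw [← infinitePi_setBernoulli_disjoint, ← nsmul_eq_mul, ← Finset.sum_const]
  refine (Finset.sum_le_sum fun i hi => ?_).trans
    (Finset.sum_le_univ_sum_of_nonneg fun _ => measureReal_nonneg)
  refine measureReal_mono fun F hF hmem => hd ?_
  refine floodSet_subset_of_no_leaving_edge (by simpa using hI i hi) hX (fun t ht e he h1 => ?_)
    n le_rfl hmem
  by_contra h2
  exact Set.disjoint_left.1 (hF t ht) he.2 ⟨he.1, h1, h2⟩

/-- Each source outside `I` contributes at least one to `∑ c i`, so the exponent exceeds `m` by at
least `|Iᶜ|`. This pays for replacing `|I|` by `k`, since `k ≤ |I| (1 + |Iᶜ|) ≤ |I| q^|Iᶜ|`. -/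
lemma card_mul_pow_le_of_sum_lt {k q : ℕ} (hq : 2 ≤ q) (c : Fin k → ℕ) (hc : ∀ i, 1 ≤ c i)
    (I : Finset (Fin k)) {m : ℕ} (hm : m < ∑ i ∈ I, c i) :
    (k : ℝ) * (1 / (q : ℝ)) ^ ∑ i, c i ≤ I.card * (1 / (q : ℝ)) ^ m := by
  have hq0 : (0 : ℝ) < q := by positivity
  have hcompl : Iᶜ.card ≤ ∑ i ∈ Iᶜ, c i := by
    simpa using Finset.card_nsmul_le_sum Iᶜ c 1 fun i _ => hc i
  have hsum := Finset.sum_add_sum_compl I c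
  have hcard := Finset.card_add_card_compl I
  rw [Fintype.card_fin] at hcard
  have hI : 1 ≤ I.card := by
    rw [Finset.one_le_card, Finset.nonempty_iff_ne_empty]
    rintro rfl
    simp at hm
  obtain ⟨r, hr⟩ : ∃ r, ∑ i, c i = m + Iᶜ.card + r :=
    Nat.exists_eq_add_of_le (by lia)
  have hpow : Iᶜ.card + 1 ≤ q ^ Iᶜ.card :=
    (Nat.lt_two_pow_self).trans_le (Nat.pow_le_pow_left hq _)
  have hk : (k : ℝ) ≤ I.card * (q : ℝ) ^ Iᶜ.card := by
    have : k ≤ I.card * q ^ Iᶜ.card := by nlinarith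
    exact_mod_cast this
  have hle : (1 / (q : ℝ)) ^ r ≤ 1 := by
    refine pow_le_one₀ (by positivity) ?_
    rw [div_le_one hq0]
    exact_mod_cast (by lia : 1 ≤ q)
  calc (k : ℝ) * (1 / (q : ℝ)) ^ ∑ i, c i
      ≤ (I.card * (q : ℝ) ^ Iᶜ.card) * (1 / (q : ℝ)) ^ ∑ i, c i := by gcongr
    _ = I.card * (1 / (q : ℝ)) ^ m * (1 / (q : ℝ)) ^ r := by
        rw [hr, pow_add, pow_add, one_div, inv_pow, inv_pow, inv_pow]; field_simp
    _ ≤ I.card * (1 / (q : ℝ)) ^ m := mul_le_of_le_one_right (by positivity) hle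

/-- The tail bound of the flooding time at the end of round `n`. -/
lemma rpow_flood_bound {q : ℕ} (hq : 2 ≤ q) {α T ε : ℝ} (hα : 0 < α) (hε : 0 < ε) (hε1 : ε ≤ 1)
    {C n : ℕ} (h : T + 1 / α * ((C : ℝ) + Real.logb 2 ε⁻¹) ≤ n) :
    (q : ℝ) ^ (-α * (n + 1 - T)) ≤ (1 / (q : ℝ)) ^ C * ε := by
  have hq0 : (0 : ℝ) < q := by positivity
  have hq1 : (1 : ℝ) ≤ q := by exact_mod_cast (by lia : 1 ≤ q)
  have hl : 0 ≤ Real.logb 2 ε⁻¹ :=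
    Real.logb_nonneg (by norm_num) ((one_le_inv₀ hε).2 hε1)
  have h1 : (C : ℝ) + Real.logb 2 ε⁻¹ ≤ α * (n - T) := by
    have h2 : 1 / α * ((C : ℝ) + Real.logb 2 ε⁻¹) ≤ n - T := by linarith
    calc (C : ℝ) + Real.logb 2 ε⁻¹ = α * (1 / α * ((C : ℝ) + Real.logb 2 ε⁻¹)) := by field_simp
      _ ≤ α * (n - T) := by gcongr
  calc (q : ℝ) ^ (-α * (n + 1 - T)) ≤ (q : ℝ) ^ (-(C : ℝ) + -Real.logb 2 ε⁻¹) :=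
        Real.rpow_le_rpow_of_exponent_le hq1 (by nlinarith)
    _ = (1 / (q : ℝ)) ^ C * (q : ℝ) ^ (-Real.logb 2 ε⁻¹) := by
        rw [Real.rpow_add hq0, Real.rpow_neg hq0.le, Real.rpow_natCast, one_div, inv_pow]
    _ ≤ (1 / (q : ℝ)) ^ C * ε := by
        gcongr
        -- The logarithm has base 2 because the prime power `q` is only known to be at least 2.
        calc (q : ℝ) ^ (-Real.logb 2 ε⁻¹) ≤ (2 : ℝ) ^ (-Real.logb 2 ε⁻¹) :=
              Real.rpow_le_rpow_of_nonpos (by norm_num) (by exact_mod_cast hq) (by linarith)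
          _ = ε := by
              rw [Real.logb_inv, neg_neg, Real.rpow_logb (by norm_num) (by norm_num) hε]

theorem mainTheorem5 {V : Type*} [Finite V] (M : ObliviousNetworkModel V) (T α : ℝ) (hα : 0 < α)
    (hM : M.Floods T α) (T' : ℕ) (ε : ℝ) (hε : 0 < ε) (d : V)
    (k : ℕ) (s : Fin k → V) (hs : Function.Injective s)
    (c : Fin k → ℕ) (hc : ∀ i, 1 ≤ c i)
    (hT' : T + 1 / α * ((∑ i, (c i : ℝ)) + Real.logb 2 ε⁻¹) ≤ (T' : ℝ)) :
    1 - ε ≤ M.law.real {E : ℕ → Set (V × V) |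
      ∃ W : WeightedPaths E T', W.Valid ∧ ∀ i, W.AchievesCapacity (s i) d (c i : ℝ)} := by
  classical
  have := Fintype.ofFinite V
  rcases lt_or_ge 1 ε with hε1 | hε1
  · exact (by linarith : 1 - ε ≤ 0).trans measureReal_nonneg
  obtain ⟨q, hqpp, hflood⟩ := hM
  have hq : 2 ≤ q := hqpp.two_le
  set G : Set (ℕ → Set (V × V)) := {E |
    ∃ W : WeightedPaths E T', W.Valid ∧ ∀ i, W.AchievesCapacity (s i) d (c i : ℝ)} with hG
  have hp : ((ObliviousNetworkModel.faultProb q : unitInterval) : ℝ) = 1 / q := rfl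
  set p := ObliviousNetworkModel.faultProb q with hpdef
  have hcut : ∀ E ∈ Gᶜ, ∃ X : ℕ → Set V, (∀ t < T', X t ⊆ X (t + 1)) ∧ d ∉ X T' ∧
      ∑ t ∈ Finset.range T', {e : V × V | e ∈ E t ∧ e.1 ∈ X t ∧ e.2 ∉ X (t + 1)}.ncard
        < ∑ i with s i ∈ X 0, c i := fun E hE =>
    (exists_weightedPaths_or_cut E T' d s hs c).resolve_left hE
  have hbad : M.law.real Gᶜ ≤ ε := by
    rcases Nat.eq_zero_or_pos k with rfl | hk
    · have hempty : Gᶜ = ∅ := Set.eq_empty_of_forall_notMem fun E hE => by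
        obtain ⟨X, -, -, hlt⟩ := hcut E hE
        simp at hlt
      rw [hempty, measureReal_empty]
      exact hε.le
    have hT'' : T + 1 / α * (((∑ i, c i : ℕ) : ℝ) + Real.logb 2 ε⁻¹) ≤ T' := by
      push_cast; exact hT'
    have hl : 0 ≤ Real.logb 2 ε⁻¹ :=
      Real.logb_nonneg (by norm_num) ((one_le_inv₀ hε).2 hε1)
    have hTT' : T ≤ T' := by
      refine le_trans ?_ hT''
      have : 0 ≤ 1 / α * (((∑ i, c i : ℕ) : ℝ) + Real.logb 2 ε⁻¹) := by positivity
      linarith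
    let A : Fin k → Set ((ℕ → Set (V × V)) × (ℕ → Set (V × V))) := fun i =>
      {ω | d ∉ floodSet (fun t => ω.1 t ∩ ω.2 t) {s i} T'}
    have hA : ∀ i, (M.faultyLaw p).real (A i) ≤ (1 / (q : ℝ)) ^ (∑ i, c i) * ε := fun i => by
      -- The excess `T' + 1 - T` is positive even when `T' = T`.
      refine le_trans ?_ ((hflood (s i) (T' + 1 - T) (by linarith)).le.trans
        (rpow_flood_bound hq hα hε hε1 hT''))
      refine measureReal_mono fun ω hω => ?_
      have h1 : ((T' + 1 : ℕ) : ℕ∞) ≤ ObliviousNetworkModel.faultyFloodTime {s i} ω :=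
        lt_floodTime_of_notMem hω
      have h2 : T + ((T' : ℝ) + 1 - T) = ((T' + 1 : ℕ) : ℝ) := by push_cast; ring
      rw [Set.mem_ofPred_eq, h2, ENNReal.ofReal_natCast]
      exact_mod_cast ENat.toENNReal_le.2 h1
    have hmarkov : ((k : ℝ) * (1 / (q : ℝ)) ^ ∑ i, c i) * M.law.real Gᶜ
        ≤ ∑ i, (M.faultyLaw p).real (A i) := by
      refine mul_measureReal_le_sum_prod _ _ A
        (fun i => (measurableSet_mem_floodSet {s i} T' d).compl) _ (by positivity) fun E hE => ?_
      obtain ⟨X, hX, hd, hlt⟩ := hcut E hE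
      refine (card_mul_pow_le_of_sum_lt hq c hc _ hlt).trans ?_
      rw [← hp]
      exact card_mul_pow_le_sum_of_cut E T' d s p hX hd _ (by simp)
    have hpos : 0 < (k : ℝ) * (1 / (q : ℝ)) ^ ∑ i, c i := by positivity
    refine le_of_mul_le_mul_left ?_ hpos
    refine hmarkov.trans ((Finset.sum_le_sum fun i _ => hA i).trans (Eq.le ?_))
    simp [mul_assoc]
  -- Subadditivity suffices, so `G` need not be measurable.
  have h1 : (1 : ℝ) ≤ M.law.real G + M.law.real Gᶜ := by
    rw [← probReal_univ (μ := M.law), ← Set.union_compl_self G]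
    exact measureReal_union_le _ _
  linarith
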